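/- **Setting.** Fix a set $\mathcal S$ of statements. A derivation rule $\mathsf r$ consists of an arity $\mathrm{ar}(\mathsf r)\in\mathbb N$, a partial function $\mathsf r:\mathcal S^{\mathrm{ar}(\mathsf r)}\rightharpoonup\mathcal S$ sending premisses to the conclusion, and a map $\mathrm{co}_{\mathsf r}:\{1,\dots,\mathrm{ar}(\mathsf r)\}\to\{0,1\}$; the $i$th premiss is called coinductive if $\mathrm{co}_{\mathsf r}(i)=1$ and inductive otherwise. Fix a family $\mathcal D$ of derivation rules. Let $\mathcal T$ be the set of all (possibly non-wellfounded) derivation trees generated by $\mathcal D$, with nodes labelled by rules and statements, such that every infinite branch crosses infinitely many coinductive premisses. We write $s=\mathsf r(s_1,\dots,s_k)$ if the last rule of $s$ is $\mathsf r$ and its immediate subtrees are $s_1,\dots,s_k$. For each $A\in\mathcal S$ let $\mathsf{trunc}_A$ be a fresh nullary rule with conclusion $A$. The truncation of $s\in\mathcal T$ at depth $d\in\mathbb N$ is given by $\lfloor s\rfloor_0=\mathsf{trunc}_A()$, where $A$ is the conclusion of $s$, and $\lfloor \mathsf r(s_1,\dots,s_k)\rfloor_{d+1}=\mathsf r(\lfloor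 s_1\rfloor_{d+1-\mathrm{co}_{\mathsf r}(1)},\dots,\lfloor s_k\rfloor_{d+1-\mathrm{co}_{\mathsf r}(k)})$. Put $\mathbf d(s,t)=\inf\{2^{-d}\mid \lfloor s\rfloor_d=\lfloor t\rfloor_d\}\in[0,\infty]$ (with $\inf\emptyset=\infty$). Let $\to_0\;\subseteq\mathcal T\times\mathcal T$ be a set of zero steps, each of which relates two derivations with the same conclusion. The relations $\to_d$ ($d\in\mathbb N$) are generated inductively by: every zero step is a step $\to_0$; and if $s_i\to_d s_i'$ then $\mathsf r(s_1,\dots,s_i,\dots,s_k)\to_{d+\mathrm{co}_{\mathsf r}(i)}\mathsf r(s_1,\dots,s_i',\dots,s_k)$. Let $\to\;=\bigcup_d\to_d$ and let $\to^*$ be its reflexive-transitive closure. A strongly converging rewriting sequence of ordinal length $\gamma$ from $s$ to $t$ consists of trees $(s_\delta)_{\delta\le\gamma}$ in $\mathcal T$ with $s_0=s$, $s_\gamma=t$, and of steps $s_\delta\to_{d_\delta}s_{\delta+1}$ for $\delta<\gamma$, such that for every limit ordinal $\gamma'\le\gamma$ one has $\lim_{\delta\to\gamma'}s_\delta=s_{\gamma'}$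 with respect to $\mathbf d$ and $\lim_{\delta\to\gamma'}d_\delta=\infty$. Write $s\to^\infty t$ if there is a strongly converging rewriting sequence, of any ordinal length, from $s$ to $t$. For ordinals $\gamma$, the relations $\to^\infty_\gamma$ and $\rightsquigarrow_\gamma$ between derivations in $\mathcal T$ with the same conclusion are defined by the following rules: * ($\mathsf{split}$) from $s\to^* s_1'\rightsquigarrow_{\delta_1}t_1\to^* s_2'\rightsquigarrow_{\delta_2}\cdots\rightsquigarrow_{\delta_m}t_m\to^* s'$, where $m\in\mathbb N$ and $\delta_1,\dots,\delta_m<\gamma$, and from $s'\rightsquigarrow_\gamma t$, infer $s\to^\infty_\gamma t$; * ($\mathsf{lift}_{\mathsf r}$, for each $\mathsf r\in\mathcal D$ of arity $k$) from $s_i\to^\infty_\gamma s_i'$ for $1\le i\le k$, infer $\mathsf r(s_1,\dots,s_k)\rightsquigarrow_\gamma\mathsf r(s_1',\dots,s_k')$, where the $i$th premiss of this rule is coinductive if and only if $\mathrm{co}_{\mathsf r}(i)=1$. All other premisses are inductive: derivations using these rules may be non-wellfounded, provided that every infinite branch crosses infinitely many coinductive premisses (that is, one takes the greatest fixed point, in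 the coinductive premisses, of the least fixed point in the inductive ones). **Theorem.** For all $s,t\in\mathcal T$, $$s\to^\infty t\iff\text{there is an ordinal }\gamma<\omega_1\text{ with }s\to^\infty_\gamma t.$$ -/

import Mathlib

open Filter Topology
open scoped ENNReal Ordinal

universe u v w

/-- A derivation rule over a set `S` of statements: a finite arity, a partial function from
premisses to conclusion, and a marking of the premisses (`true` = coinductive, `false` = inductive). -/
structure DerivationRule (S : Type u) where
  arity : ℕ
  app : (Fin arity → S) →. S
  coind : Fin arity → Bool

section Trees

variable {S : Type u} {R : Type v}

/-- A node carries the name of a rule and a statement, and has one child per premiss of the rule. -/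
def nodeFunctor (D : R → DerivationRule S) : PFunctor.{max u v, 0} :=
  ⟨R × S, fun a => Fin (D a.1).arity⟩

/-- Arbitrary (possibly infinite) trees with nodes labelled by rules and statements,
without any correctness condition. -/
abbrev PreTree (D : R → DerivationRule S) : Type (max u v) :=
  (nodeFunctor D).M

namespace PreTree

variable {D : R → DerivationRule S}

/-- The last rule. -/
def rule (t : PreTree D) : R := t.head.1

/-- The statement at the root. -/
def concl (t : PreTree D) : S := t.head.2

/-- The `i`th immediate subtree. -/
def child (t : PreTree D) (i : Fin (D t.rule).arity) : PreTree D := t.children i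

/-- `Subtree t u`: `u` is a (not necessarily immediate or proper) subtree of `t`. -/
inductive Subtree : PreTree D → PreTree D → Prop
  | refl (t : PreTree D) : Subtree t t
  | child {t : PreTree D} (i : Fin (D t.rule).arity) {u : PreTree D}
      (h : Subtree (t.child i) u) : Subtree t u

/-- At every node, the rule is applicable to the conclusions of the immediate subtrees, and the
statement at the node is the result of applying it. -/
def LocallyCorrect (t : PreTree D) : Prop :=
  ∀ u, Subtree t u → u.concl ∈ (D u.rule).app fun i => (u.child i).concl

/-- All infinite branches cross infinitely many coinductive premisses. A branch is given by the
successive subtrees `b n` and the choices `i n` of a premiss. -/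
def Productive (t : PreTree D) : Prop :=
  ∀ (b : ℕ → PreTree D) (i : ∀ n, Fin (D (b n).rule).arity),
    b 0 = t → (∀ n, b (n + 1) = (b n).child (i n)) →
      ∃ᶠ n in atTop, (D (b n).rule).coind (i n) = true

end PreTree

/-- The set of all non-wellfounded derivation trees generated by the family `D` of rules. -/
def DTree (D : R → DerivationRule S) : Type (max u v) :=
  {t : PreTree D // t.LocallyCorrect ∧ t.Productive}

/-- The family `D` extended with a nullary rule `trunc_A` with conclusion `A` for each
statement `A`. -/
def withTrunc (D : R → DerivationRule S) : S ⊕ R → DerivationRule S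
  | Sum.inl A => ⟨0, fun _ => Part.some A, Fin.elim0⟩
  | Sum.inr r => D r

/-- One layer of the truncation at depth `d`. -/
def truncStep (D : R → DerivationRule S) :
    ℕ × PreTree D → nodeFunctor (withTrunc D) (ℕ × PreTree D)
  | (0, t) => ⟨(Sum.inl t.concl, t.concl), fun i => Fin.elim0 i⟩
  | (d + 1, t) => ⟨(Sum.inr t.rule, t.concl),
      fun i => (d + 1 - ((D t.rule).coind i).toNat, t.child i)⟩

/-- Truncation at depth `d`; see `PreTree.dest_trunc_zero` and `PreTree.dest_trunc_succ` for its
defining equations. -/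
def PreTree.trunc {D : R → DerivationRule S} (d : ℕ) (t : PreTree D) : PreTree (withTrunc D) :=
  PFunctor.M.corec (truncStep D) (d, t)

theorem PreTree.dest_trunc_zero {D : R → DerivationRule S} (t : PreTree D) :
    (t.trunc 0).dest = ⟨(Sum.inl t.concl, t.concl), fun i => Fin.elim0 i⟩ := by
  unfold PreTree.trunc
  rw [PFunctor.M.dest_corec]
  refine congrArg (Sigma.mk _) (funext fun i => ?_)
  exact Fin.elim0 i

theorem PreTree.dest_trunc_succ {D : R → DerivationRule S} (d : ℕ) (t : PreTree D) :
    (t.trunc (d + 1)).dest = ⟨(Sum.inr t.rule, t.concl),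
      fun i => (t.child i).trunc (d + 1 - ((D t.rule).coind i).toNat)⟩ := by
  unfold PreTree.trunc
  rw [PFunctor.M.dest_corec]
  rfl

namespace DTree

variable {D : R → DerivationRule S}

/-- The conclusion of a derivation tree. -/
def concl (s : DTree D) : S := s.1.concl

/-- `s.IsApp r c` means `s = r(c₁, …, c_k)`: the last rule of `s` is `r` and its immediate subtrees
are the `c i`. (As `s` is locally correct, `r` is then defined on the conclusions of the `c i`,
with value the conclusion of `s`.) -/
def IsApp (s : DTree D) (r : R) (c : Fin (D r).arity → DTree D) : Prop :=
  ∃ A : S, s.1.dest = ⟨(r, A), fun i => (c i).1⟩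

/-- The distance `inf {2⁻ᵈ | trunc d s = trunc d t}`. It is taken in `[0, ∞]`, so that it is `∞`
(and not `0`) if `s` and `t` have distinct conclusions, i.e. if no truncations coincide. -/
noncomputable def dist (s t : DTree D) : ℝ≥0∞ :=
  ⨅ (d : ℕ) (_ : s.1.trunc d = t.1.trunc d), (2⁻¹ : ℝ≥0∞) ^ d

end DTree

end Trees

section Rewriting

variable {S : Type u} {R : Type v} {D : R → DerivationRule S}

/-- `Step Z d s t`: a rewriting step at depth `d` from `s` to `t`, in the rewriting relation
generated by the set `Z` of zero steps. -/
inductive Step (Z : DTree D → DTree D → Prop) : ℕ → DTree D → DTree D → Prop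
  | zero {s t : DTree D} (h : Z s t) : Step Z 0 s t
  | context {d : ℕ} {r : R} {c : Fin (D r).arity → DTree D} (i : Fin (D r).arity)
      {u s s' : DTree D} (h : Step Z d (c i) u) (hs : s.IsApp r c)
      (hs' : s'.IsApp r (Function.update c i u)) :
      Step Z (d + ((D r).coind i).toNat) s s'

/-- The reflexive-transitive closure of the rewriting relation (of steps at any depth). -/
def Steps (Z : DTree D → DTree D → Prop) : DTree D → DTree D → Prop :=
  Relation.ReflTransGen fun s t => ∃ d, Step Z d s t

/-- A strongly converging rewriting sequence of length `γ` from `s` to `t`.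
Only the trees `term δ` for `δ ≤ γ` and the depths `depth δ` for `δ < γ` matter. -/
structure StronglyConvergingSeq (Z : DTree D → DTree D → Prop) (γ : Ordinal.{w})
    (s t : DTree D) where
  term : Ordinal.{w} → DTree D
  depth : Ordinal.{w} → ℕ
  source : term 0 = s
  target : term γ = t
  step : ∀ δ < γ, Step Z (depth δ) (term δ) (term (δ + 1))
  tendsto_term : ∀ l ≤ γ, Order.IsSuccLimit l →
    Tendsto (fun δ => (term δ).dist (term l)) (𝓝[<] l) (𝓝 0)
  tendsto_depth : ∀ l ≤ γ, Order.IsSuccLimit l → Tendsto depth (𝓝[<] l) atTop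

/-- Infinitary rewriting: there is a strongly converging rewriting sequence, of any ordinal length,
from `s` to `t`. -/
def InfRed (Z : DTree D → DTree D → Prop) (s t : DTree D) : Prop :=
  ∃ γ : Ordinal.{w}, Nonempty (StronglyConvergingSeq Z γ s t)

/-! The rules `split` and `lift_r`. The coinductive premisses are read in a given family `X` of
relations, the other ones inductively. -/

mutual

/-- Conclusions of the rule `split`. -/
inductive SplitRule (Z : DTree D → DTree D → Prop) (X : Ordinal.{w} → DTree D → DTree D → Prop) :
    Ordinal.{w} → DTree D → DTree D → Prop
  | split {γ : Ordinal.{w}} {m : ℕ} {s s' t : DTree D} (h : InterleavedSeq Z X γ m s s')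
      (h' : LiftRule Z X γ s' t) : SplitRule Z X γ s t

/-- Conclusions of the rules `lift_r`; they relate derivations of the same statement. -/
inductive LiftRule (Z : DTree D → DTree D → Prop) (X : Ordinal.{w} → DTree D → DTree D → Prop) :
    Ordinal.{w} → DTree D → DTree D → Prop
  | lift {γ : Ordinal.{w}} (r : R) {c c' : Fin (D r).arity → DTree D} {s t : DTree D}
      (hs : s.IsApp r c) (ht : t.IsApp r c') (hst : s.concl = t.concl)
      (hcoind : ∀ i, (D r).coind i = true → X γ (c i) (c' i))
      (hind : ∀ i, (D r).coind i = false → SplitRule Z X γ (c i) (c' i)) :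
      LiftRule Z X γ s t

/-- Finite sequences `s ⟶* s₁ ⇝[δ₁] t₁ ⟶* s₂ ⇝[δ₂] ⋯ ⇝[δₘ] tₘ ⟶* s'` with all `δᵢ < γ`,
where `⇝[δ]` is the relation concluded by the rules `lift_r`. -/
inductive InterleavedSeq (Z : DTree D → DTree D → Prop)
    (X : Ordinal.{w} → DTree D → DTree D → Prop) :
    Ordinal.{w} → ℕ → DTree D → DTree D → Prop
  | nil {γ : Ordinal.{w}} {s s' : DTree D} (h : Steps Z s s') : InterleavedSeq Z X γ 0 s s'
  | cons {γ δ : Ordinal.{w}} {m : ℕ} {s s₁ t₁ s' : DTree D} (h : Steps Z s s₁) (hδ : δ < γ)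
      (h₁ : LiftRule Z X δ s₁ t₁) (h' : InterleavedSeq Z X γ m t₁ s') :
      InterleavedSeq Z X γ (m + 1) s s'

end

/-- The relation `⟶∞[γ]` defined by the mixed inductive and coinductive rules `split` and `lift_r`:
the greatest fixed point, in the coinductive premisses, of the least fixed point, in the inductive
ones. (Equivalently, derivability by a non-wellfounded derivation whose infinite branches all cross
infinitely many coinductive premisses.) -/
def CoindRed (Z : DTree D → DTree D → Prop) (γ : Ordinal.{w}) (s t : DTree D) : Prop :=
  ∃ X : Ordinal.{w} → DTree D → DTree D → Prop,
    (∀ δ s' t', X δ s' t' → SplitRule Z X δ s' t') ∧ X γ s t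

end Rewriting

section Trees

variable {S : Type u} {R : Type v} {D : R → DerivationRule S}

namespace PreTree

theorem LocallyCorrect.child {t : PreTree D} (h : t.LocallyCorrect) (i : Fin (D t.rule).arity) :
    (t.child i).LocallyCorrect :=
  fun u hu => h u (.child i hu)

theorem Productive.child {t : PreTree D} (h : t.Productive) (i : Fin (D t.rule).arity) :
    (t.child i).Productive := by
  intro b j hb hj
  let b' : ℕ → PreTree D := fun n => Nat.casesOn n t b
  let j' : ∀ n, Fin (D (b' n).rule).arity := fun n =>
    Nat.casesOn (motive := fun n => Fin (D (b' n).rule).arity) n i j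
  have h' := h b' j' rfl (by rintro (_ | n); exacts [hb, hj n])
  rw [frequently_atTop] at h' ⊢
  intro a
  obtain ⟨n, hn, hc⟩ := h' (a + 1)
  obtain _ | n := n
  · omega
  · exact ⟨n, by omega, hc⟩

theorem locallyCorrect_of_child {t : PreTree D}
    (h : t.concl ∈ (D t.rule).app fun i => (t.child i).concl)
    (hc : ∀ i, (t.child i).LocallyCorrect) : t.LocallyCorrect := by
  intro u hu
  cases hu with
  | refl => exact h
  | child i hu => exact hc i u hu

theorem productive_of_child {t : PreTree D} (hc : ∀ i, (t.child i).Productive) :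
    t.Productive := by
  intro b j hb hj
  subst hb
  have h := hc (j 0) (fun n => b (n + 1)) (fun n => j (n + 1)) (hj 0) fun n => hj (n + 1)
  rw [frequently_atTop] at h ⊢
  intro a
  obtain ⟨n, hn, hc⟩ := h a
  exact ⟨n + 1, by omega, hc⟩

theorem dest_injective : Function.Injective (PFunctor.M.dest : PreTree D → _) := fun x y h => by
  rw [← PFunctor.M.mk_dest x, h, PFunctor.M.mk_dest]

theorem dest_trunc_of_dest {x : PreTree D} {r : R} {A : S} {f : Fin (D r).arity → PreTree D}
    (h : x.dest = ⟨(r, A), f⟩) (n : ℕ) :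
    (x.trunc (n + 1)).dest = ⟨(Sum.inr r, A),
      fun i => (f i).trunc (n + 1 - ((D r).coind i).toNat)⟩ := by
  let F : nodeFunctor D (PreTree D) → nodeFunctor (withTrunc D) (PreTree (withTrunc D)) :=
    fun y => ⟨(Sum.inr y.1.1, y.1.2),
      fun i => (y.2 i).trunc (n + 1 - ((D y.1.1).coind i).toNat)⟩
  have : (x.trunc (n + 1)).dest = F x.dest := dest_trunc_succ n x
  rw [this, h]

theorem trunc_zero_eq_iff {x y : PreTree D} : x.trunc 0 = y.trunc 0 ↔ x.concl = y.concl := by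
  rw [← dest_injective.eq_iff, dest_trunc_zero, dest_trunc_zero]
  constructor
  · intro h
    exact congrArg (fun z => z.1.2) h
  · intro h
    rw [h]

end PreTree

namespace DTree

/-- The immediate subtrees of a derivation tree, as derivation trees. -/
def sub (s : DTree D) (i : Fin (D s.1.rule).arity) : DTree D :=
  ⟨s.1.child i, s.2.1.child i, s.2.2.child i⟩

theorem isApp_sub (s : DTree D) : s.IsApp s.1.rule s.sub :=
  ⟨s.1.concl, rfl⟩

/-- The last rule of a tree and its immediate subtrees. -/
theorem exists_isApp (s : DTree D) : ∃ r c, s.IsApp r c :=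
  ⟨s.1.rule, s.sub, s.isApp_sub⟩

theorem IsApp.dest_eq {s : DTree D} {r : R} {c : Fin (D r).arity → DTree D} (h : s.IsApp r c) :
    s.1.dest = ⟨(r, s.concl), fun i => (c i).1⟩ := by
  obtain ⟨A, hA⟩ := h
  have : s.concl = A := congrArg (fun z => z.1.2) hA
  rw [hA, this]

theorem IsApp.concl_mem {s : DTree D} {r : R} {c : Fin (D r).arity → DTree D}
    (h : s.IsApp r c) : s.concl ∈ (D r).app fun i => (c i).concl := by
  let P : nodeFunctor D (PreTree D) → Prop :=
    fun y => y.1.2 ∈ (D y.1.1).app fun i => (y.2 i).concl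
  have : P s.1.dest := s.2.1 s.1 (.refl _)
  rw [h.dest_eq] at this
  exact this

theorem IsApp.rule_eq {s : DTree D} {r r' : R} {c : Fin (D r).arity → DTree D}
    {c' : Fin (D r').arity → DTree D} (h : s.IsApp r c) (h' : s.IsApp r' c') : r = r' :=
  congrArg (fun z => z.1.1) (h.dest_eq.symm.trans h'.dest_eq)

theorem IsApp.children_eq {s : DTree D} {r : R} {c c' : Fin (D r).arity → DTree D}
    (h : s.IsApp r c) (h' : s.IsApp r c') : c = c' := by
  have := eq_of_heq (Sigma.mk.inj (h.dest_eq.symm.trans h'.dest_eq)).2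
  exact funext fun i => Subtype.ext (congrFun this i)

theorem IsApp.concl_eq {s t : DTree D} {r : R} {c c' : Fin (D r).arity → DTree D}
    (h : s.IsApp r c) (h' : t.IsApp r c') (hc : ∀ i, (c i).concl = (c' i).concl) :
    s.concl = t.concl := by
  have h₁ := h.concl_mem
  have h₂ := h'.concl_mem
  rw [funext hc] at h₁
  exact Part.mem_unique h₁ h₂

theorem IsApp.unique {s t : DTree D} {r : R} {c : Fin (D r).arity → DTree D}
    (h : s.IsApp r c) (h' : t.IsApp r c) : s = t := by
  apply Subtype.ext
  apply PreTree.dest_injective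
  rw [h.dest_eq, h'.dest_eq, h.concl_eq h' fun _ => rfl]

/-- Immediate subtrees may be replaced by trees with the same conclusions. -/
theorem IsApp.exists_replace {s : DTree D} {r : R} {c : Fin (D r).arity → DTree D}
    (h : s.IsApp r c) {c' : Fin (D r).arity → DTree D} (hc : ∀ i, (c i).concl = (c' i).concl) :
    ∃ t : DTree D, t.IsApp r c' := by
  let y : nodeFunctor D (PreTree D) := ⟨(r, s.concl), fun i => (c' i).1⟩
  let x : PreTree D := PFunctor.M.mk y
  have hx : x.dest = y := PFunctor.M.dest_mk y
  have hm : y.1.2 ∈ (D y.1.1).app fun i => (y.2 i).concl := by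
    have := h.concl_mem
    rw [funext hc] at this
    exact this
  have hl : ∀ i, (y.2 i).LocallyCorrect := fun i => (c' i).2.1
  have hp : ∀ i, (y.2 i).Productive := fun i => (c' i).2.2
  rw [← hx] at hm hl hp
  exact ⟨⟨x, PreTree.locallyCorrect_of_child hm hl, PreTree.productive_of_child hp⟩, s.concl, hx⟩

/-- Induction along inductive premisses. -/
theorem inductive_premiss_induction {P : DTree D → Prop}
    (H : ∀ s, (∀ r c, s.IsApp r c → ∀ i, (D r).coind i = false → P (c i)) → P s) (s : DTree D) :
    P s := by
  by_contra hs
  have key : ∀ x : {x : DTree D // ¬ P x}, ∃ i : Fin (D x.1.1.rule).arity,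
      (D x.1.1.rule).coind i = false ∧ ¬ P (x.1.sub i) := by
    intro x
    by_contra hx
    push Not at hx
    apply x.2
    apply H
    intro r c hc i hi
    obtain rfl := hc.rule_eq x.1.isApp_sub
    obtain rfl := hc.children_eq x.1.isApp_sub
    exact hx i hi
  choose j hj hP using key
  let b : ℕ → {x : DTree D // ¬ P x} := fun n =>
    Nat.rec ⟨s, hs⟩ (fun _ x => ⟨x.1.sub (j x), hP x⟩) n
  have := s.2.2 (fun n => (b n).1.1) (fun n => j (b n)) rfl fun n => rfl
  obtain ⟨n, hn⟩ := this.exists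
  rw [hj] at hn
  exact absurd hn (by simp)

/-! ### Agreement of truncations -/

/-- `s` and `t` have the same truncation at depth `n`. -/
def AgreeTo (n : ℕ) (s t : DTree D) : Prop := s.1.trunc n = t.1.trunc n

theorem agreeTo_zero {s t : DTree D} : AgreeTo 0 s t ↔ s.concl = t.concl :=
  PreTree.trunc_zero_eq_iff

theorem AgreeTo.refl (n : ℕ) (s : DTree D) : AgreeTo n s s := rfl

theorem AgreeTo.symm {n : ℕ} {s t : DTree D} (h : AgreeTo n s t) : AgreeTo n t s := Eq.symm h

theorem AgreeTo.trans {n : ℕ} {s t p : DTree D} (h : AgreeTo n s t) (h' : AgreeTo n t p) :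
    AgreeTo n s p :=
  Eq.trans h h'

theorem IsApp.agreeTo_succ {n : ℕ} {s t : DTree D} {r : R} {c c' : Fin (D r).arity → DTree D}
    (h : s.IsApp r c) (h' : t.IsApp r c') :
    AgreeTo (n + 1) s t ↔ s.concl = t.concl ∧
      ∀ i, AgreeTo (n + 1 - ((D r).coind i).toNat) (c i) (c' i) := by
  unfold AgreeTo
  rw [← PreTree.dest_injective.eq_iff, PreTree.dest_trunc_of_dest h.dest_eq,
    PreTree.dest_trunc_of_dest h'.dest_eq]
  constructor
  · intro e
    have e₁ : s.concl = t.concl := congrArg (fun z => z.1.2) e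
    rw [e₁] at e
    have e₂ := eq_of_heq (Sigma.mk.inj e).2
    exact ⟨e₁, fun i => congrFun e₂ i⟩
  · rintro ⟨e₁, e₂⟩
    rw [e₁]
    exact congrArg (Sigma.mk _) (funext e₂)

theorem IsApp.exists_of_agreeTo_succ {n : ℕ} {s t : DTree D} {r : R}
    {c : Fin (D r).arity → DTree D} (h : s.IsApp r c) (hst : AgreeTo (n + 1) s t) :
    ∃ c', t.IsApp r c' := by
  obtain ⟨r', c', h'⟩ := t.exists_isApp
  unfold AgreeTo at hst
  rw [← PreTree.dest_injective.eq_iff, PreTree.dest_trunc_of_dest h.dest_eq,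
    PreTree.dest_trunc_of_dest h'.dest_eq] at hst
  have : (Sum.inr r : S ⊕ R) = Sum.inr r' := congrArg (fun z => z.1.1) hst
  obtain rfl := Sum.inr.inj this
  exact ⟨c', h'⟩

theorem AgreeTo.concl_eq {n : ℕ} {s t : DTree D} (h : AgreeTo n s t) : s.concl = t.concl := by
  obtain _ | n := n
  · exact agreeTo_zero.1 h
  · obtain ⟨r, c, hc⟩ := s.exists_isApp
    obtain ⟨c', hc'⟩ := hc.exists_of_agreeTo_succ h
    exact ((hc.agreeTo_succ hc').1 h).1

theorem AgreeTo.pred {n : ℕ} {s t : DTree D} (h : AgreeTo (n + 1) s t) : AgreeTo n s t := by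
  induction n generalizing s t with
  | zero => exact agreeTo_zero.2 h.concl_eq
  | succ n ihn =>
    induction s using inductive_premiss_induction generalizing t with
    | H s ih =>
      obtain ⟨r, c, hc⟩ := s.exists_isApp
      obtain ⟨c', hc'⟩ := hc.exists_of_agreeTo_succ h
      rw [hc.agreeTo_succ hc'] at h ⊢
      refine ⟨h.1, fun i => ?_⟩
      have hi := h.2 i
      cases hco : (D r).coind i with
      | false =>
        rw [hco] at hi
        exact ih r c hc i hco hi
      | true =>
        rw [hco] at hi
        exact ihn hi

theorem AgreeTo.mono {m n : ℕ} (hmn : m ≤ n) {s t : DTree D} (h : AgreeTo n s t) :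
    AgreeTo m s t := by
  induction hmn with
  | refl => exact h
  | step _ ih => exact ih h.pred

/-- Trees with the same truncations are equal. -/
theorem eq_of_forall_agreeTo {s t : DTree D} (h : ∀ n, AgreeTo n s t) : s = t := by
  apply Subtype.ext
  refine PFunctor.M.bisim
    (fun x y => ∃ s t : DTree D, x = s.1 ∧ y = t.1 ∧ ∀ n, AgreeTo n s t) ?_ s.1 t.1
    ⟨s, t, rfl, rfl, h⟩
  rintro _ _ ⟨s, t, rfl, rfl, h⟩
  obtain ⟨r, c, hc⟩ := s.exists_isApp
  obtain ⟨c', hc'⟩ := hc.exists_of_agreeTo_succ (h 1)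
  refine ⟨_, _, _, hc.dest_eq, ?_, fun i => ⟨c i, c' i, rfl, rfl, fun n => ?_⟩⟩
  · rw [(h 0).concl_eq]
    exact hc'.dest_eq
  · have := ((hc.agreeTo_succ hc').1 (h (n + 1))).2 i
    exact this.mono (by cases (D r).coind i <;> simp)

theorem AgreeTo.dist_le {n : ℕ} {s t : DTree D} (h : AgreeTo n s t) :
    s.dist t ≤ (2⁻¹ : ℝ≥0∞) ^ n :=
  iInf₂_le n h

theorem agreeTo_of_dist_lt {n : ℕ} {s t : DTree D} (h : s.dist t < (2⁻¹ : ℝ≥0∞) ^ n) :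
    AgreeTo n s t := by
  unfold dist at h
  simp only [iInf_lt_iff] at h
  obtain ⟨d, hd, hlt⟩ := h
  refine AgreeTo.mono ?_ (show AgreeTo d s t from hd)
  by_contra hdn
  exact absurd hlt (not_lt.2 (pow_le_pow_right_of_le_one' (by simp) (by omega)))

end DTree

end Trees

section Rewriting

variable {S : Type u} {R : Type v} {D : R → DerivationRule S} {Z : DTree D → DTree D → Prop}

open DTree

theorem Step.agreeTo (hZ : ∀ s t, Z s t → s.concl = t.concl) {d n : ℕ} {s t : DTree D}
    (h : Step Z d s t) (hn : n ≤ d) : AgreeTo n s t := by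
  induction h generalizing n with
  | zero h =>
    obtain rfl : n = 0 := by omega
    exact agreeTo_zero.2 (hZ _ _ h)
  | @context d r c i u s s' h hs hs' ih =>
    have hc : s.concl = s'.concl := hs.concl_eq hs' fun j => by
      by_cases hj : j = i
      · subst hj
        simpa using (ih (Nat.zero_le d)).concl_eq
      · simp [hj]
    obtain _ | n := n
    · exact agreeTo_zero.2 hc
    · refine (hs.agreeTo_succ hs').2 ⟨hc, fun j => ?_⟩
      by_cases hj : j = i
      · subst hj
        simpa using ih (by omega)
      · simpa [hj] using AgreeTo.refl _ _

theorem Steps.concl_eq (hZ : ∀ s t, Z s t → s.concl = t.concl) {s t : DTree D}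
    (h : Steps Z s t) : s.concl = t.concl := by
  induction h with
  | refl => rfl
  | tail _ h ih =>
    obtain ⟨d, h⟩ := h
    exact ih.trans (h.agreeTo hZ le_rfl).concl_eq

/-- `f` is a strongly converging sequence on the interval `[a, b]` whose steps, at depths given by
`d` and of depth at least `n`, belong to the family `P` of relations. -/
structure IsRun (P : ℕ → DTree D → DTree D → Prop) (n : ℕ) (a b : Ordinal.{w})
    (f : Ordinal.{w} → DTree D) (d : Ordinal.{w} → ℕ) : Prop where
  step : ∀ δ, a ≤ δ → δ < b → P (d δ) (f δ) (f (δ + 1))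
  le_depth : ∀ δ, a ≤ δ → δ < b → n ≤ d δ
  lim_term : ∀ l, a < l → l ≤ b → Order.IsSuccLimit l →
    ∀ k, ∃ β < l, ∀ δ, β ≤ δ → δ < l → AgreeTo k (f δ) (f l)
  lim_depth : ∀ l, a < l → l ≤ b → Order.IsSuccLimit l →
    ∀ k, ∃ β < l, ∀ δ, β ≤ δ → δ < l → k ≤ d δ

section

variable {P : ℕ → DTree D → DTree D → Prop} {n : ℕ} {a b : Ordinal.{w}}
  {f : Ordinal.{w} → DTree D} {d : Ordinal.{w} → ℕ}

theorem IsRun.mono {a' b' : Ordinal.{w}} (h : IsRun P n a b f d) (ha : a ≤ a') (hb : b' ≤ b) :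
    IsRun P n a' b' f d where
  step δ h₁ h₂ := h.step δ (ha.trans h₁) (h₂.trans_le hb)
  le_depth δ h₁ h₂ := h.le_depth δ (ha.trans h₁) (h₂.trans_le hb)
  lim_term l h₁ h₂ := h.lim_term l (ha.trans_lt h₁) (h₂.trans hb)
  lim_depth l h₁ h₂ := h.lim_depth l (ha.trans_lt h₁) (h₂.trans hb)

theorem IsRun.of_le_depth {m : ℕ} (h : IsRun P n a b f d)
    (hm : ∀ δ, a ≤ δ → δ < b → m ≤ d δ) : IsRun P m a b f d :=
  ⟨h.step, hm, h.lim_term, h.lim_depth⟩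

/-- Along a run with steps of depth at least `n`, the truncation at depth `n` does not change. -/
theorem IsRun.agreeTo (hP : ∀ d s t, P d s t → ∀ n ≤ d, AgreeTo n s t) (h : IsRun P n a b f d)
    {δ : Ordinal.{w}} (h₁ : a ≤ δ) (h₂ : δ ≤ b) : AgreeTo n (f a) (f δ) := by
  induction δ using Ordinal.limitRecOn with
  | zero =>
    obtain rfl : a = 0 := by simpa using h₁
    exact AgreeTo.refl _ _
  | add_one δ ih =>
    rcases h₁.eq_or_lt with rfl | h₁
    · exact AgreeTo.refl _ _
    · have h₁ := Order.lt_add_one_iff.1 h₁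
      have h₂ := Order.add_one_le_iff.1 h₂
      exact (ih h₁ h₂.le).trans (hP _ _ _ (h.step δ h₁ h₂) _ (h.le_depth δ h₁ h₂))
  | limit l hl ih =>
    rcases h₁.eq_or_lt with rfl | h₁
    · exact AgreeTo.refl _ _
    · obtain ⟨β, hβ, H⟩ := h.lim_term l h₁ h₂ hl n
      have hm : max a β < l := max_lt h₁ hβ
      exact (ih _ hm (le_max_left _ _) (hm.le.trans h₂)).trans (H _ (le_max_right _ _) hm)

end

theorem eventually_nhdsLT_iff {p : Ordinal.{w} → Prop} {l : Ordinal.{w}}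
    (hl : Order.IsSuccLimit l) :
    (∀ᶠ δ in 𝓝[<] l, p δ) ↔ ∃ β < l, ∀ δ, β ≤ δ → δ < l → p δ := by
  rw [(nhdsLT_basis_of_exists_lt ⟨⊥, hl.bot_lt⟩).eventually_iff]
  constructor
  · rintro ⟨β, hβ, H⟩
    exact ⟨β + 1, hl.add_one_lt hβ, fun δ h₁ h₂ => H ⟨Order.add_one_le_iff.1 h₁, h₂⟩⟩
  · rintro ⟨β, hβ, H⟩
    exact ⟨β, hβ, fun δ h => H δ h.1.le h.2⟩

theorem tendsto_nhdsLT_atTop_iff {d : Ordinal.{w} → ℕ} {l : Ordinal.{w}}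
    (hl : Order.IsSuccLimit l) :
    Tendsto d (𝓝[<] l) atTop ↔ ∀ k, ∃ β < l, ∀ δ, β ≤ δ → δ < l → k ≤ d δ := by
  rw [tendsto_atTop]
  exact forall_congr' fun k => eventually_nhdsLT_iff hl

theorem tendsto_dist_iff {f : Ordinal.{w} → DTree D} {l : Ordinal.{w}}
    (hl : Order.IsSuccLimit l) :
    Tendsto (fun δ => (f δ).dist (f l)) (𝓝[<] l) (𝓝 0) ↔
      ∀ k, ∃ β < l, ∀ δ, β ≤ δ → δ < l → AgreeTo k (f δ) (f l) := by
  constructor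
  · intro h k
    have := h.eventually_lt_const (u := (2⁻¹ : ℝ≥0∞) ^ k) (ENNReal.pow_pos (by simp) k)
    exact (eventually_nhdsLT_iff hl).1 (this.mono fun δ => agreeTo_of_dist_lt)
  · intro h
    rw [ENNReal.tendsto_nhds_zero]
    intro ε hε
    obtain ⟨k, hk⟩ := ENNReal.exists_inv_two_pow_lt hε.ne'
    exact ((eventually_nhdsLT_iff hl).2 (h k)).mono fun δ hδ => hδ.dist_le.trans hk.le

theorem nonempty_stronglyConvergingSeq_iff {γ : Ordinal.{w}} {s t : DTree D} :
    Nonempty (StronglyConvergingSeq Z γ s t) ↔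
      ∃ f d, IsRun (Step Z) 0 0 γ f d ∧ f 0 = s ∧ f γ = t := by
  constructor
  · rintro ⟨q⟩
    exact ⟨q.term, q.depth, ⟨fun δ _ h => q.step δ h, fun _ _ _ => Nat.zero_le _,
      fun l _ h hl => (tendsto_dist_iff hl).1 (q.tendsto_term l h hl),
      fun l _ h hl => (tendsto_nhdsLT_atTop_iff hl).1 (q.tendsto_depth l h hl)⟩,
      q.source, q.target⟩
  · rintro ⟨f, d, h, hs, ht⟩
    exact ⟨f, d, hs, ht, fun δ hδ => h.step δ zero_le hδ,
      fun l h₁ hl => (tendsto_dist_iff hl).2 (h.lim_term l hl.bot_lt h₁ hl),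
      fun l h₁ hl => (tendsto_nhdsLT_atTop_iff hl).2 (h.lim_depth l hl.bot_lt h₁ hl)⟩

end Rewriting

section Decomposition

variable {S : Type u} {R : Type v} {D : R → DerivationRule S} {Z : DTree D → DTree D → Prop}

open DTree

/-- A step at depth `d`, or no change at all. -/
def LazyStep (Z : DTree D → DTree D → Prop) (d : ℕ) (s t : DTree D) : Prop :=
  s = t ∨ Step Z d s t

theorem LazyStep.agreeTo (hZ : ∀ s t, Z s t → s.concl = t.concl) (d : ℕ) (s t : DTree D)
    (h : LazyStep Z d s t) (n : ℕ) (hn : n ≤ d) : AgreeTo n s t := by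
  rcases h with rfl | h
  · exact AgreeTo.refl _ _
  · exact h.agreeTo hZ hn

/-- A lazy step at positive depth acts on the immediate subtrees. -/
theorem LazyStep.children {d : ℕ} {s t : DTree D} {r : R} {c c' : Fin (D r).arity → DTree D}
    (h : LazyStep Z d s t) (hd : 1 ≤ d) (hs : s.IsApp r c) (ht : t.IsApp r c')
    (i : Fin (D r).arity) : LazyStep Z (d - ((D r).coind i).toNat) (c i) (c' i) := by
  rcases h with rfl | h
  · exact Or.inl (congrFun (hs.children_eq ht) i)
  · cases h with
    | zero => omega
    | @context d r₀ c₀ j u _ _ h hs₀ ht₀ =>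
      obtain rfl := hs₀.rule_eq hs
      obtain rfl := hs₀.children_eq hs
      obtain rfl := ht₀.children_eq ht
      by_cases hij : i = j
      · subst hij
        refine Or.inr ?_
        simpa using h
      · exact Or.inl (by simp [hij])

/-- A lazy run at positive depth induces lazy runs on the immediate subtrees. -/
theorem IsRun.children (hZ : ∀ s t, Z s t → s.concl = t.concl) {a b : Ordinal.{w}}
    {f : Ordinal.{w} → DTree D} {d : Ordinal.{w} → ℕ} (h : IsRun (LazyStep Z) 1 a b f d) {r : R}
    {c : Fin (D r).arity → DTree D} (hc : (f a).IsApp r c) :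
    ∃ g : Ordinal.{w} → Fin (D r).arity → DTree D,
      (∀ δ, a ≤ δ → δ ≤ b → (f δ).IsApp r (g δ)) ∧
      ∀ i, IsRun (LazyStep Z) (1 - ((D r).coind i).toNat) a b (fun δ => g δ i)
        (fun δ => d δ - ((D r).coind i).toNat) := by
  have hex : ∀ δ, ∃ c', a ≤ δ → δ ≤ b → (f δ).IsApp r c' := by
    intro δ
    by_cases hδ : a ≤ δ ∧ δ ≤ b
    · obtain ⟨c', hc'⟩ := hc.exists_of_agreeTo_succ (h.agreeTo (LazyStep.agreeTo hZ) hδ.1 hδ.2)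
      exact ⟨c', fun _ _ => hc'⟩
    · exact ⟨c, fun h₁ h₂ => absurd ⟨h₁, h₂⟩ hδ⟩
  choose g hg using hex
  have hco : ∀ i, ((D r).coind i).toNat ≤ 1 := fun i => Bool.toNat_le _
  refine ⟨g, hg, fun i => ⟨fun δ h₁ h₂ => ?_, fun δ h₁ h₂ => ?_, fun l h₁ h₂ hl k => ?_,
    fun l h₁ h₂ hl k => ?_⟩⟩
  · exact (h.step δ h₁ h₂).children (h.le_depth δ h₁ h₂) (hg δ h₁ h₂.le)
      (hg (δ + 1) (h₁.trans (Order.le_succ δ)) (Order.add_one_le_of_lt h₂)) i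
  · exact Nat.sub_le_sub_right (h.le_depth δ h₁ h₂) _
  · obtain ⟨β, hβ, H⟩ := h.lim_term l h₁ h₂ hl (k + 1)
    refine ⟨max a β, max_lt h₁ hβ, fun δ hδ hδl => ?_⟩
    have hδa := (le_max_left _ _).trans hδ
    have := ((hg δ hδa (hδl.le.trans h₂)).agreeTo_succ (hg l h₁.le h₂)).1
      (H δ ((le_max_right _ _).trans hδ) hδl)
    exact (this.2 i).mono (by have := hco i; omega)
  · obtain ⟨β, hβ, H⟩ := h.lim_depth l h₁ h₂ hl (k + 1)
    refine ⟨β, hβ, fun δ hδ hδl => ?_⟩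
    have := H δ hδ hδl
    have := hco i
    omega

/-- `s` and `t` are connected by a lazy run that ends not after `γ`. -/
def LazyRed (Z : DTree D → DTree D → Prop) (γ : Ordinal.{w}) (s t : DTree D) : Prop :=
  ∃ a b f d, a ≤ b ∧ b ≤ γ ∧ IsRun (LazyStep Z) 0 a b f d ∧ f a = s ∧ f b = t

theorem IsRun.liftRule (hZ : ∀ s t, Z s t → s.concl = t.concl) {a b γ : Ordinal.{w}}
    (hab : a ≤ b) (hb : b ≤ γ) {f : Ordinal.{w} → DTree D} {d : Ordinal.{w} → ℕ}
    (h : IsRun (LazyStep Z) 1 a b f d) : LiftRule Z (LazyRed Z) γ (f a) (f b) := by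
  generalize hs : f a = s
  induction s using inductive_premiss_induction generalizing f d with
  | H s ih =>
    subst hs
    obtain ⟨r, c, hc⟩ := (f a).exists_isApp
    obtain ⟨g, hg, hrun⟩ := h.children hZ hc
    have hga := hg a le_rfl hab
    refine .lift r hga (hg b hab le_rfl) (h.agreeTo (LazyStep.agreeTo hZ) hab le_rfl).concl_eq
      (fun i _ => ?_) fun i hi => ?_
    · exact ⟨a, b, _, _, hab, hb, (hrun i).of_le_depth fun _ _ _ => Nat.zero_le _, rfl, rfl⟩
    · have hr := hrun i
      have h₁ : 1 - ((D r).coind i).toNat = 1 := by simp [hi]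
      rw [h₁] at hr
      exact .split (.nil .refl) (ih r _ hga i hi hr rfl)

theorem InterleavedSeq.append {X : Ordinal.{w} → DTree D → DTree D → Prop} {γ δ : Ordinal.{w}}
    {m : ℕ} {s s₁ t₁ t : DTree D} (h : InterleavedSeq Z X γ m s s₁) (hδ : δ < γ)
    (h₁ : LiftRule Z X δ s₁ t₁) (h' : Steps Z t₁ t) : InterleavedSeq Z X γ (m + 1) s t := by
  induction m generalizing s with
  | zero =>
    cases h with
    | nil h => exact .cons h hδ h₁ (.nil h')
  | succ m ih =>
    cases h with
    | cons h₂ hδ' h₃ h₄ => exact .cons h₂ hδ' h₃ (ih h₄)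

theorem LazyStep.steps {d : ℕ} {s t : DTree D} (h : LazyStep Z d s t) : Steps Z s t := by
  rcases h with rfl | h
  · exact .refl
  · exact .single ⟨d, h⟩

/-- A lazy run decomposes into an interleaved sequence and a run at positive depth. -/
theorem IsRun.exists_interleavedSeq (hZ : ∀ s t, Z s t → s.concl = t.concl) {a b γ : Ordinal.{w}}
    (hb : b ≤ γ) {f : Ordinal.{w} → DTree D} {d : Ordinal.{w} → ℕ}
    (h : IsRun (LazyStep Z) 0 a b f d) {δ : Ordinal.{w}} (h₁ : a ≤ δ) (h₂ : δ ≤ b) :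
    ∃ β m, a ≤ β ∧ β ≤ δ ∧ InterleavedSeq Z (LazyRed Z) γ m (f a) (f β) ∧
      ∀ ε, β ≤ ε → ε < δ → 1 ≤ d ε := by
  have base : ∃ β m, a ≤ β ∧ β ≤ a ∧ InterleavedSeq Z (LazyRed Z) γ m (f a) (f β) ∧
      ∀ ε, β ≤ ε → ε < a → 1 ≤ d ε :=
    ⟨a, 0, le_rfl, le_rfl, .nil .refl, fun ε h₁ h₂ => absurd h₂ h₁.not_gt⟩
  induction δ using Ordinal.limitRecOn with
  | zero =>
    obtain rfl : a = 0 := by simpa using h₁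
    exact base
  | add_one δ ih =>
    rcases h₁.eq_or_lt with rfl | h₁
    · exact base
    have h₁ := Order.lt_add_one_iff.1 h₁
    have h₂ := Order.add_one_le_iff.1 h₂
    obtain ⟨β, m, haβ, hβδ, hseq, hd⟩ := ih h₁ h₂.le
    by_cases h0 : 1 ≤ d δ
    · refine ⟨β, m, haβ, hβδ.trans (Order.le_succ δ), hseq, fun ε h₃ h₄ => ?_⟩
      rcases (Order.lt_add_one_iff.1 h₄).eq_or_lt with rfl | h₄
      · exact h0
      · exact hd ε h₃ h₄
    · have hr : IsRun (LazyStep Z) 1 β δ f d := (h.mono haβ h₂.le).of_le_depth hd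
      exact ⟨δ + 1, m + 1, h₁.trans (Order.le_succ δ), le_rfl,
        hseq.append (h₂.trans_le hb) (hr.liftRule hZ hβδ le_rfl) (h.step δ h₁ h₂).steps,
        fun ε h₃ h₄ => absurd h₄ h₃.not_gt⟩
  | limit l hl ih =>
    rcases h₁.eq_or_lt with rfl | h₁
    · exact base
    obtain ⟨β₀, hβ₀, H⟩ := h.lim_depth l h₁ h₂ hl 1
    have hm : max a β₀ < l := max_lt h₁ hβ₀
    obtain ⟨β, m, haβ, hβδ, hseq, hd⟩ := ih _ hm (le_max_left _ _) (hm.le.trans h₂)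
    refine ⟨β, m, haβ, hβδ.trans hm.le, hseq, fun ε h₃ h₄ => ?_⟩
    rcases lt_or_ge ε (max a β₀) with h₅ | h₅
    · exact hd ε h₃ h₅
    · exact H ε ((le_max_right _ _).trans h₅) h₄

theorem LazyRed.splitRule (hZ : ∀ s t, Z s t → s.concl = t.concl) {γ : Ordinal.{w}}
    {s t : DTree D} (h : LazyRed Z γ s t) : SplitRule Z (LazyRed Z) γ s t := by
  obtain ⟨a, b, f, d, hab, hb, h, rfl, rfl⟩ := h
  obtain ⟨β, m, haβ, hβb, hseq, hd⟩ := h.exists_interleavedSeq hZ hb hab le_rfl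
  exact .split hseq (((h.mono haβ le_rfl).of_le_depth hd).liftRule hZ hβb hb)

/-- A strongly converging sequence has finitely many steps of any given depth. -/
theorem IsRun.finite_depth_lt {P : ℕ → DTree D → DTree D → Prop} {n : ℕ} {b : Ordinal.{w}}
    {f : Ordinal.{w} → DTree D} {d : Ordinal.{w} → ℕ} (h : IsRun P n 0 b f d) (k : ℕ)
    {δ : Ordinal.{w}} (hδ : δ ≤ b) : {ε | ε < δ ∧ d ε < k}.Finite := by
  induction δ using Ordinal.limitRecOn with
  | zero => simp
  | add_one δ ih =>
    refine ((ih ((Order.le_succ δ).trans hδ)).insert δ).subset fun ε hε => ?_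
    rcases (Order.lt_add_one_iff.1 hε.1).eq_or_lt with h₁ | h₁
    · exact Or.inl h₁
    · exact Or.inr ⟨h₁, hε.2⟩
  | limit l hl ih =>
    obtain ⟨β, hβ, H⟩ := h.lim_depth l hl.bot_lt hδ hl k
    refine (ih β hβ (hβ.le.trans hδ)).subset fun ε hε => ⟨?_, hε.2⟩
    by_contra hβε
    exact absurd (H ε (not_lt.1 hβε) hε.1) (not_le.2 hε.2)

theorem IsRun.lt_omega_one {P : ℕ → DTree D → DTree D → Prop} {n : ℕ} {b : Ordinal.{w}}
    {f : Ordinal.{w} → DTree D} {d : Ordinal.{w} → ℕ} (h : IsRun P n 0 b f d) : b < ω₁ := by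
  have hc : (Set.Iio b).Countable := by
    refine (Set.countable_iUnion fun k => (h.finite_depth_lt k le_rfl).countable).mono
      fun ε hε => ?_
    exact Set.mem_iUnion.2 ⟨d ε + 1, hε, Nat.lt_succ_self _⟩
  rw [← Cardinal.le_aleph0_iff_set_countable, Cardinal.mk_Iio_ordinal] at hc
  rw [← Cardinal.ord_aleph, Cardinal.lt_ord, ← Cardinal.succ_aleph0, Order.lt_succ_iff]
  exact Cardinal.lift_le_aleph0.1 hc

theorem InfRed.exists_coindRed (hZ : ∀ s t, Z s t → s.concl = t.concl) {s t : DTree D}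
    (h : InfRed.{u, v, w} Z s t) : ∃ γ : Ordinal.{w}, γ < ω₁ ∧ CoindRed Z γ s t := by
  obtain ⟨γ, h⟩ := h
  obtain ⟨f, d, h, hs, ht⟩ := nonempty_stronglyConvergingSeq_iff.1 h
  exact ⟨γ, h.lt_omega_one, LazyRed Z, fun _ _ _ => LazyRed.splitRule hZ, 0, γ, f, d, zero_le,
    le_rfl, ⟨fun δ h₁ h₂ => Or.inr (h.step δ h₁ h₂), h.le_depth, h.lim_term, h.lim_depth⟩,
    hs, ht⟩

end Decomposition

section Composition

variable {S : Type u} {R : Type v} {D : R → DerivationRule S} {Z : DTree D → DTree D → Prop}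

open DTree

/-- From every ordinal `a` there starts a strongly converging sequence from `s` to `t` all of whose
steps have depth at least `n`. -/
def DeepRed (Z : DTree D → DTree D → Prop) (n : ℕ) (s t : DTree D) : Prop :=
  ∀ a : Ordinal.{w}, ∃ b f d, a ≤ b ∧ IsRun (Step Z) n a b f d ∧ f a = s ∧ f b = t

theorem IsRun.congr {P : ℕ → DTree D → DTree D → Prop} {n : ℕ} {a b : Ordinal.{w}}
    {f f' : Ordinal.{w} → DTree D} {d d' : Ordinal.{w} → ℕ} (h : IsRun P n a b f d)
    (hf : ∀ δ, a ≤ δ → δ ≤ b → f' δ = f δ) (hd : ∀ δ, a ≤ δ → δ < b → d' δ = d δ) :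
    IsRun P n a b f' d' where
  step δ h₁ h₂ := by
    rw [hf δ h₁ h₂.le, hd δ h₁ h₂,
      hf (δ + 1) (h₁.trans (Order.le_succ δ)) (Order.add_one_le_of_lt h₂)]
    exact h.step δ h₁ h₂
  le_depth δ h₁ h₂ := by
    rw [hd δ h₁ h₂]
    exact h.le_depth δ h₁ h₂
  lim_term l h₁ h₂ hl k := by
    obtain ⟨β, hβ, H⟩ := h.lim_term l h₁ h₂ hl k
    refine ⟨max a β, max_lt h₁ hβ, fun δ h₃ h₄ => ?_⟩
    rw [hf δ ((le_max_left _ _).trans h₃) (h₄.le.trans h₂), hf l h₁.le h₂]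
    exact H δ ((le_max_right _ _).trans h₃) h₄
  lim_depth l h₁ h₂ hl k := by
    obtain ⟨β, hβ, H⟩ := h.lim_depth l h₁ h₂ hl k
    refine ⟨max a β, max_lt h₁ hβ, fun δ h₃ h₄ => ?_⟩
    rw [hd δ ((le_max_left _ _).trans h₃) (h₄.trans_le h₂)]
    exact H δ ((le_max_right _ _).trans h₃) h₄

theorem IsRun.append {P : ℕ → DTree D → DTree D → Prop} {n : ℕ} {a b c : Ordinal.{w}}
    {f : Ordinal.{w} → DTree D} {d : Ordinal.{w} → ℕ} (h : IsRun P n a b f d)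
    (h' : IsRun P n b c f d) : IsRun P n a c f d where
  step δ h₁ h₂ := by
    rcases lt_or_ge δ b with h₃ | h₃
    exacts [h.step δ h₁ h₃, h'.step δ h₃ h₂]
  le_depth δ h₁ h₂ := by
    rcases lt_or_ge δ b with h₃ | h₃
    exacts [h.le_depth δ h₁ h₃, h'.le_depth δ h₃ h₂]
  lim_term l h₁ h₂ := by
    rcases le_or_gt l b with h₃ | h₃
    exacts [h.lim_term l h₁ h₃, h'.lim_term l h₃ h₂]
  lim_depth l h₁ h₂ := by
    rcases le_or_gt l b with h₃ | h₃
    exacts [h.lim_depth l h₁ h₃, h'.lim_depth l h₃ h₂]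

namespace DeepRed

theorem refl (n : ℕ) (s : DTree D) : DeepRed.{u, v, w} Z n s s := fun a =>
  ⟨a, fun _ => s, fun _ => 0, le_rfl,
    ⟨fun _ h₁ h₂ => absurd h₂ h₁.not_gt, fun _ h₁ h₂ => absurd h₂ h₁.not_gt,
      fun _ h₁ h₂ => absurd h₁ h₂.not_gt, fun _ h₁ h₂ => absurd h₁ h₂.not_gt⟩, rfl, rfl⟩

theorem mono {m n : ℕ} (hmn : m ≤ n) {s t : DTree D} (h : DeepRed.{u, v, w} Z n s t) :
    DeepRed.{u, v, w} Z m s t := by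
  intro a
  obtain ⟨b, f, d, hab, h, hs, ht⟩ := h a
  exact ⟨b, f, d, hab, h.of_le_depth fun δ h₁ h₂ => hmn.trans (h.le_depth δ h₁ h₂), hs, ht⟩

theorem of_step {d : ℕ} {s t : DTree D} (h : Step Z d s t) : DeepRed.{u, v, w} Z d s t := by
  intro a
  have hlim : ∀ l, a < l → l ≤ a + 1 → ¬ Order.IsSuccLimit l := by
    intro l h₁ h₂ hl
    exact absurd (hl.add_one_lt h₁) h₂.not_gt
  refine ⟨a + 1, fun δ => if δ ≤ a then s else t, fun _ => d, Order.le_succ a,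
    ⟨fun δ h₁ h₂ => ?_, fun _ _ _ => le_rfl, fun l h₁ h₂ hl => absurd hl (hlim l h₁ h₂),
      fun l h₁ h₂ hl => absurd hl (hlim l h₁ h₂)⟩, by simp, by simp⟩
  obtain rfl : δ = a := le_antisymm (Order.lt_add_one_iff.1 h₂) h₁
  simpa using h

theorem trans {n : ℕ} {s t p : DTree D} (h : DeepRed.{u, v, w} Z n s t)
    (h' : DeepRed.{u, v, w} Z n t p) : DeepRed.{u, v, w} Z n s p := by
  intro a
  obtain ⟨b, f, d, hab, h, hs, ht⟩ := h a
  obtain ⟨c, f', d', hbc, h', ht', hp⟩ := h' b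
  refine ⟨c, fun δ => if δ ≤ b then f δ else f' δ, fun δ => if δ < b then d δ else d' δ,
    hab.trans hbc, (h.congr (fun δ _ h₂ => if_pos h₂) fun δ _ h₂ => if_pos h₂).append
      (h'.congr (fun δ h₁ _ => ?_) fun δ h₁ _ => if_neg h₁.not_gt), ?_, ?_⟩
  · rcases h₁.eq_or_lt with rfl | h₁
    · rw [if_pos le_rfl, ht, ht']
    · exact if_neg h₁.not_ge
  · exact (if_pos hab).trans hs
  · rcases hbc.eq_or_lt with rfl | h₁
    · exact (if_pos le_rfl).trans (ht.trans (ht'.symm.trans hp))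
    · exact (if_neg h₁.not_ge).trans hp

theorem concl_eq (hZ : ∀ s t, Z s t → s.concl = t.concl) {n : ℕ} {s t : DTree D}
    (h : DeepRed.{u, v, w} Z n s t) : s.concl = t.concl := by
  obtain ⟨b, f, d, hab, hr, rfl, rfl⟩ := h 0
  exact (hr.agreeTo (fun _ _ _ h _ => h.agreeTo hZ) hab le_rfl).concl_eq

theorem of_steps {s t : DTree D} (h : Steps Z s t) : DeepRed.{u, v, w} Z 0 s t := by
  induction h with
  | refl => exact refl 0 s
  | tail _ h ih =>
    obtain ⟨d, h⟩ := h
    exact ih.trans ((of_step h).mono (Nat.zero_le d))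

theorem context (hZ : ∀ s t, Z s t → s.concl = t.concl) {n : ℕ} {r : R}
    {c : Fin (D r).arity → DTree D} (i : Fin (D r).arity) {u s s' : DTree D}
    (h : DeepRed.{u, v, w} Z n (c i) u) (hs : s.IsApp r c)
    (hs' : s'.IsApp r (Function.update c i u)) :
    DeepRed.{u, v, w} Z (n + ((D r).coind i).toNat) s s' := by
  intro a
  obtain ⟨b, f, d, hab, hr, hfa, hfb⟩ := h a
  have hex : ∀ δ, ∃ x : DTree D, a ≤ δ → δ ≤ b → x.IsApp r (Function.update c i (f δ)) := by
    intro δ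
    by_cases hδ : a ≤ δ ∧ δ ≤ b
    · obtain ⟨x, hx⟩ := hs.exists_replace (c' := Function.update c i (f δ)) fun j => by
        by_cases hj : j = i
        · subst hj
          rw [Function.update_self, ← hfa]
          exact (hr.agreeTo (fun _ _ _ h _ => h.agreeTo hZ) hδ.1 hδ.2).concl_eq
        · rw [Function.update_of_ne hj]
      exact ⟨x, fun _ _ => hx⟩
    · exact ⟨s, fun h₁ h₂ => absurd ⟨h₁, h₂⟩ hδ⟩
  choose g hg using hex
  refine ⟨b, g, fun δ => d δ + ((D r).coind i).toNat, hab,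
    ⟨fun δ h₁ h₂ => ?_, fun δ h₁ h₂ => Nat.add_le_add_right (hr.le_depth δ h₁ h₂) _,
      fun l h₁ h₂ hl k => ?_, fun l h₁ h₂ hl k => ?_⟩, ?_, ?_⟩
  · refine .context i (u := f (δ + 1)) ?_ (hg δ h₁ h₂.le) ?_
    · rw [Function.update_self]
      exact hr.step δ h₁ h₂
    · rw [Function.update_idem]
      exact hg (δ + 1) (h₁.trans (Order.le_succ δ)) (Order.add_one_le_of_lt h₂)
  · obtain ⟨β, hβ, H⟩ := hr.lim_term l h₁ h₂ hl (k + 1)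
    refine ⟨max a β, max_lt h₁ hβ, fun δ h₃ h₄ => AgreeTo.pred ?_⟩
    have hδ := H δ ((le_max_right _ _).trans h₃) h₄
    have hδa := hg δ ((le_max_left _ _).trans h₃) (h₄.le.trans h₂)
    have hc : ∀ j, AgreeTo (k + 1) (Function.update c i (f δ) j)
        (Function.update c i (f l) j) := fun j => by
      by_cases hj : j = i
      · subst hj
        simpa using hδ
      · simpa [hj] using AgreeTo.refl _ _
    exact (hδa.agreeTo_succ (hg l h₁.le h₂)).2
      ⟨hδa.concl_eq (hg l h₁.le h₂) fun j => (hc j).concl_eq,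
        fun j => (hc j).mono (Nat.sub_le _ _)⟩
  · obtain ⟨β, hβ, H⟩ := hr.lim_depth l h₁ h₂ hl k
    exact ⟨β, hβ, fun δ h₃ h₄ => (H δ h₃ h₄).trans (Nat.le_add_right _ _)⟩
  · refine (hg a le_rfl hab).unique ?_
    rw [hfa, Function.update_eq_self]
    exact hs
  · refine (hg b hab le_rfl).unique ?_
    rw [hfb]
    exact hs'

/-- Reductions of all immediate subtrees combine to a reduction of the tree. -/
theorem congr (hZ : ∀ s t, Z s t → s.concl = t.concl) {n : ℕ} {r : R}
    {c c' : Fin (D r).arity → DTree D} {s t : DTree D} (hs : s.IsApp r c) (ht : t.IsApp r c')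
    (h : ∀ i, DeepRed.{u, v, w} Z (n - ((D r).coind i).toNat) (c i) (c' i)) :
    DeepRed.{u, v, w} Z n s t := by
  classical
  suffices H : ∀ I : Finset (Fin (D r).arity), ∃ x : DTree D,
      x.IsApp r (I.piecewise c' c) ∧ DeepRed.{u, v, w} Z n s x by
    obtain ⟨x, hx, hsx⟩ := H Finset.univ
    rw [Finset.piecewise_univ] at hx
    rwa [← hx.unique ht]
  intro I
  induction I using Finset.induction_on with
  | empty => exact ⟨s, by simpa using hs, refl n s⟩
  | insert i I hi ih =>
    obtain ⟨x, hx, hsx⟩ := ih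
    have hcx : I.piecewise c' c i = c i := by simp [hi]
    have hstep : DeepRed.{u, v, w} Z (n - ((D r).coind i).toNat) (I.piecewise c' c i) (c' i) := by
      rw [hcx]
      exact h i
    obtain ⟨y, hy⟩ := hx.exists_replace (c' := Function.update (I.piecewise c' c) i (c' i))
      fun j => by
        by_cases hj : j = i
        · subst hj
          rw [Function.update_self]
          exact hstep.concl_eq hZ
        · rw [Function.update_of_ne hj]
    refine ⟨y, ?_, hsx.trans ((context hZ i hstep hx hy).mono (by omega))⟩
    rw [Finset.piecewise_insert]
    exact hy

/-- Reductions `s k ⟶ s (k + 1)` at depths at least `k` compose to a reduction to the limit. -/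
theorem of_tendsto (hZ : ∀ s t, Z s t → s.concl = t.concl) {s : ℕ → DTree D} {t : DTree D}
    (h : ∀ k, DeepRed.{u, v, w} Z k (s k) (s (k + 1))) (ht : ∀ k, AgreeTo k (s k) t) :
    DeepRed.{u, v, w} Z 0 (s 0) t := by
  classical
  intro a
  choose B F E hB hrun hsrc htgt using h
  let b : ℕ → Ordinal.{w} := fun n => Nat.rec a (fun k x => B k x) n
  have hb : Monotone b := monotone_nat_of_le_succ fun k => hB k (b k)
  have hsb : ∀ k, F k (b k) (b k) = s k := fun k => hsrc k (b k)
  have htb : ∀ k, F k (b k) (b (k + 1)) = s (k + 1) := fun k => htgt k (b k)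
  have hrun' : ∀ k, IsRun (Step Z) k (b k) (b (k + 1)) (F k (b k)) (E k (b k)) :=
    fun k => hrun k (b k)
  have hconst : ∀ j k, j ≤ k → b j = b k → s j = s k := by
    intro j k hjk
    induction hjk with
    | refl => exact fun _ => rfl
    | @step k hjk ih =>
      intro e
      have e₁ : b j = b k := le_antisymm (hb hjk) ((hb (Nat.le_succ k)).trans e.ge)
      have e₂ : b k = b (k + 1) := e₁.symm.trans e
      rw [ih e₁, ← hsb k, ← htb k, ← e₂]
  let T : Ordinal.{w} → DTree D := fun δ =>
    if h : ∃ k, δ < b (k + 1) then F (Nat.find h) (b (Nat.find h)) δ else t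
  let d : Ordinal.{w} → ℕ := fun δ =>
    if h : ∃ k, δ < b (k + 1) then E (Nat.find h) (b (Nat.find h)) δ else 0
  have hfind : ∀ k δ, b k ≤ δ → δ < b (k + 1) → ∀ h : ∃ k, δ < b (k + 1), Nat.find h = k := by
    intro k δ h₁ h₂ h
    refine le_antisymm (Nat.find_min' h h₂) ?_
    by_contra hlt
    exact absurd ((Nat.find_spec h).trans_le (hb (show Nat.find h + 1 ≤ k by omega))) h₁.not_gt
  have hd : ∀ k δ, b k ≤ δ → δ < b (k + 1) → d δ = E k (b k) δ := by
    intro k δ h₁ h₂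
    have hex : ∃ k, δ < b (k + 1) := ⟨k, h₂⟩
    simp only [d, dif_pos hex, hfind k δ h₁ h₂ hex]
  have hT : ∀ k δ, b k ≤ δ → δ < b (k + 1) → T δ = F k (b k) δ := by
    intro k δ h₁ h₂
    have hex : ∃ k, δ < b (k + 1) := ⟨k, h₂⟩
    simp only [T, dif_pos hex, hfind k δ h₁ h₂ hex]
  have hcover : ∀ k δ, a ≤ δ → δ < b k → ∃ j, b j ≤ δ ∧ δ < b (j + 1) := by
    intro k
    induction k with
    | zero => exact fun δ h₁ h₂ => absurd h₂ h₁.not_gt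
    | succ k ih =>
      intro δ h₁ h₂
      rcases lt_or_ge δ (b k) with h₃ | h₃
      exacts [ih δ h₁ h₃, ⟨k, h₃, h₂⟩]
  have hTb : ∀ k, T (b k) = s k := by
    intro k
    rcases Classical.em (∃ j, b k < b (j + 1)) with hex | hex
    · obtain ⟨j, hj⟩ := hex
      obtain ⟨j, h₁, h₂⟩ := hcover (j + 1) (b k) (hb (Nat.zero_le k)) hj
      have hkj : k ≤ j := by
        by_contra hlt
        exact absurd (hb (show j + 1 ≤ k by omega)) h₂.not_ge
      have e : b k = b j := le_antisymm (hb hkj) h₁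
      rw [hT j _ h₁ h₂, hconst k j hkj e, e, hsb]
    · have : T (b k) = t := by simp only [T, dif_neg hex]
      rw [this]
      refine (eq_of_forall_agreeTo fun n => ?_).symm
      have e : s k = s (max k n) := hconst k _ (le_max_left _ _)
        (le_antisymm (hb (le_max_left _ _)) (not_lt.1 fun hlt => hex ⟨max k n, hlt.trans_le
          (hb (Nat.le_succ _))⟩))
      rw [e]
      exact (ht _).mono (le_max_right _ _)
  have hT' : ∀ k δ, b k ≤ δ → δ ≤ b (k + 1) → T δ = F k (b k) δ := by
    intro k δ h₁ h₂
    rcases h₂.eq_or_lt with rfl | h₂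
    · exact (hTb (k + 1)).trans (htb k).symm
    · exact hT k δ h₁ h₂
  have hR : ∀ k, IsRun (Step Z) k (b k) (b (k + 1)) T d := fun k =>
    (hrun' k).congr (hT' k) (hd k)
  have hlt : ∀ δ, a ≤ δ → δ < ⨆ k, b k → ∃ j, b j ≤ δ ∧ δ < b (j + 1) := by
    intro δ h₁ h₂
    obtain ⟨k, hk⟩ := Ordinal.lt_iSup_iff.1 h₂
    exact hcover k δ h₁ hk
  have hle : ∀ k, b k ≤ ⨆ k, b k := fun k => Ordinal.le_iSup b k
  have hpos : ∀ l, a < l → (∃ k, l ≤ b k) → ∃ j, b j < l ∧ l ≤ b (j + 1) := by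
    rintro l h₁ ⟨k, hk⟩
    induction k with
    | zero => exact absurd h₁ hk.not_gt
    | succ k ih =>
      rcases le_or_gt l (b k) with h₃ | h₃
      exacts [ih h₃, ⟨k, h₃, hk⟩]
  have hlate : ∀ n δ, b n ≤ δ → δ < ⨆ k, b k → ∃ j, n ≤ j ∧ b j ≤ δ ∧ δ < b (j + 1) := by
    intro n δ h₁ h₂
    obtain ⟨j, h₃, h₄⟩ := hlt δ ((hb (Nat.zero_le n)).trans h₁) h₂
    refine ⟨j, ?_, h₃, h₄⟩
    by_contra hjn
    exact absurd ((hb (show j + 1 ≤ n by omega)).trans h₁) h₄.not_ge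
  refine ⟨⨆ k, b k, T, d, hle 0, ⟨fun δ h₁ h₂ => ?_, fun _ _ _ => Nat.zero_le _,
    fun l h₁ h₂ hl n => ?_, fun l h₁ h₂ hl n => ?_⟩, hTb 0, ?_⟩
  · obtain ⟨j, h₃, h₄⟩ := hlt δ h₁ h₂
    exact (hR j).step δ h₃ h₄
  · rcases Classical.em (∃ k, l ≤ b k) with hk | hk
    · obtain ⟨j, h₃, h₄⟩ := hpos l h₁ hk
      exact (hR j).lim_term l h₃ h₄ hl n
    · have hTl : T l = t := dif_neg fun ⟨k, hk'⟩ => hk ⟨k + 1, hk'.le⟩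
      push Not at hk
      refine ⟨b n, hk n, fun δ h₃ h₄ => ?_⟩
      obtain ⟨j, hj, h₅, h₆⟩ := hlate n δ h₃ (h₄.trans_le h₂)
      have := (hR j).agreeTo (fun _ _ _ h _ => h.agreeTo hZ) h₅ h₆.le
      rw [hTb] at this
      rw [hTl]
      exact (this.symm.trans (ht j)).mono hj
  · rcases Classical.em (∃ k, l ≤ b k) with hk | hk
    · obtain ⟨j, h₃, h₄⟩ := hpos l h₁ hk
      exact (hR j).lim_depth l h₃ h₄ hl n
    · push Not at hk
      refine ⟨b n, hk n, fun δ h₃ h₄ => ?_⟩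
      obtain ⟨j, hj, h₅, h₆⟩ := hlate n δ h₃ (h₄.trans_le h₂)
      exact hj.trans ((hR j).le_depth δ h₅ h₆)
  · exact dif_neg fun ⟨k, hk⟩ => absurd (hle (k + 1)) hk.not_ge

theorem infRed {n : ℕ} {s t : DTree D} (h : DeepRed.{u, v, w} Z n s t) :
    InfRed.{u, v, w} Z s t := by
  obtain ⟨b, f, d, -, h, hs, ht⟩ := h 0
  exact ⟨b, nonempty_stronglyConvergingSeq_iff.2 ⟨f, d, h.of_le_depth fun _ _ _ => Nat.zero_le _, hs, ht⟩⟩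

end DeepRed

/-- `s` and `t` coincide up to depth `k`, and their subtrees at depth `k` are related by `X`. -/
inductive RelatedBelow (X : DTree D → DTree D → Prop) : ℕ → DTree D → DTree D → Prop
  | base {s t : DTree D} (h : X s t) : RelatedBelow X 0 s t
  | node {k : ℕ} {r : R} {c c' : Fin (D r).arity → DTree D} {s t : DTree D} (hs : s.IsApp r c)
      (ht : t.IsApp r c') (hst : s.concl = t.concl)
      (h : ∀ i, RelatedBelow X (k + 1 - ((D r).coind i).toNat) (c i) (c' i)) :
      RelatedBelow X (k + 1) s t

theorem RelatedBelow.agreeTo {X : DTree D → DTree D → Prop}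
    (hX : ∀ s t, X s t → s.concl = t.concl) {k : ℕ} {s t : DTree D} (h : RelatedBelow X k s t) :
    AgreeTo k s t := by
  induction h with
  | base h => exact agreeTo_zero.2 (hX _ _ h)
  | node hs ht hst _ ih => exact (hs.agreeTo_succ ht).2 ⟨hst, ih⟩

/-- If the relation `X` can be refined by one level, then so can `RelatedBelow X k`. -/
theorem RelatedBelow.refine (hZ : ∀ s t, Z s t → s.concl = t.concl)
    {X : DTree D → DTree D → Prop}
    (hX : ∀ s t, X s t → ∃ s', DeepRed.{u, v, w} Z 0 s s' ∧ RelatedBelow X 1 s' t)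
    {k : ℕ} {s t : DTree D} (h : RelatedBelow X k s t) :
    ∃ s', DeepRed.{u, v, w} Z k s s' ∧ RelatedBelow X (k + 1) s' t := by
  induction h with
  | base h => exact hX _ _ h
  | @node k r c c' s t hs ht hst _ ih =>
    choose x hx hxc using ih
    obtain ⟨s', hs'⟩ := hs.exists_replace fun i => (hx i).concl_eq hZ
    have hss' : DeepRed.{u, v, w} Z (k + 1) s s' := .congr hZ hs hs' hx
    refine ⟨s', hss', .node hs' ht ((hss'.concl_eq hZ).symm.trans hst) fun i => ?_⟩
    have e : k + 1 + 1 - ((D r).coind i).toNat = k + 1 - ((D r).coind i).toNat + 1 := by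
      have := Bool.toNat_le ((D r).coind i)
      omega
    rw [e]
    exact hxc i

theorem LiftRule.concl_eq {X : Ordinal.{w} → DTree D → DTree D → Prop} {γ : Ordinal.{w}}
    {s t : DTree D} (h : LiftRule Z X γ s t) : s.concl = t.concl := by
  cases h with
  | lift r hs ht hst => exact hst

theorem InterleavedSeq.concl_eq (hZ : ∀ s t, Z s t → s.concl = t.concl)
    {X : Ordinal.{w} → DTree D → DTree D → Prop} {γ : Ordinal.{w}} {m : ℕ} {s t : DTree D}
    (h : InterleavedSeq Z X γ m s t) : s.concl = t.concl := by
  induction m generalizing s with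
  | zero =>
    cases h with
    | nil h => exact h.concl_eq hZ
  | succ m ih =>
    cases h with
    | cons h₁ _ h₂ h₃ => exact (h₁.concl_eq hZ).trans (h₂.concl_eq.trans (ih h₃))

theorem SplitRule.concl_eq (hZ : ∀ s t, Z s t → s.concl = t.concl)
    {X : Ordinal.{w} → DTree D → DTree D → Prop} {γ : Ordinal.{w}} {s t : DTree D}
    (h : SplitRule Z X γ s t) : s.concl = t.concl := by
  cases h with
  | split h h' => exact (h.concl_eq hZ).trans h'.concl_eq

theorem LiftRule.splitRule {X : Ordinal.{w} → DTree D → DTree D → Prop} {γ : Ordinal.{w}}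
    {s t : DTree D} (h : LiftRule Z X γ s t) : SplitRule Z X γ s t :=
  .split (.nil .refl) h

theorem InterleavedSeq.deepRed {X : Ordinal.{w} → DTree D → DTree D → Prop} {γ : Ordinal.{w}}
    (ih : ∀ δ < γ, ∀ s t, SplitRule Z X δ s t → DeepRed.{u, v, w} Z 0 s t) {m : ℕ}
    {s t : DTree D} (h : InterleavedSeq Z X γ m s t) : DeepRed.{u, v, w} Z 0 s t := by
  induction m generalizing s with
  | zero =>
    cases h with
    | nil h => exact .of_steps h
  | succ m ihm =>
    cases h with
    | cons h₁ hδ h₂ h₃ =>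
      exact (DeepRed.of_steps h₁).trans ((ih _ hδ _ _ h₂.splitRule).trans (ihm h₃))

/-- A conclusion of `split` reduces to a tree that agrees with the target up to depth one. -/
theorem SplitRule.refine (hZ : ∀ s t, Z s t → s.concl = t.concl)
    {X : Ordinal.{w} → DTree D → DTree D → Prop}
    (hX : ∀ δ s' t', X δ s' t' → SplitRule Z X δ s' t') {γ : Ordinal.{w}}
    (ih : ∀ δ < γ, ∀ s t, SplitRule Z X δ s t → DeepRed.{u, v, w} Z 0 s t) {s t : DTree D}
    (h : SplitRule Z X γ s t) :
    ∃ s', DeepRed.{u, v, w} Z 0 s s' ∧ RelatedBelow (SplitRule Z X γ) 1 s' t := by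
  refine SplitRule.rec (motive_1 := fun γ s t _ =>
      (∀ δ < γ, ∀ s t, SplitRule Z X δ s t → DeepRed.{u, v, w} Z 0 s t) →
      ∃ s', DeepRed.{u, v, w} Z 0 s s' ∧ RelatedBelow (SplitRule Z X γ) 1 s' t)
    (motive_2 := fun γ s t _ =>
      (∀ δ < γ, ∀ s t, SplitRule Z X δ s t → DeepRed.{u, v, w} Z 0 s t) →
      ∃ s', DeepRed.{u, v, w} Z 0 s s' ∧ RelatedBelow (SplitRule Z X γ) 1 s' t)
    (motive_3 := fun _ _ _ _ _ => True) ?_ ?_ (fun _ => trivial) (fun _ _ _ _ _ _ => trivial) h ih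
  · intro γ m s s' t h _ _ ihl hγ
    obtain ⟨x, hx, hxt⟩ := ihl hγ
    exact ⟨x, (h.deepRed hγ).trans hx, hxt⟩
  · intro γ r c c' s t hs ht hst hcoind _ ihc hγ
    have hex : ∀ i, ∃ x, DeepRed.{u, v, w} Z 0 (c i) x ∧
        RelatedBelow (SplitRule Z X γ) (0 + 1 - ((D r).coind i).toNat) x (c' i) := by
      intro i
      cases hi : (D r).coind i with
      | false => exact ihc i hi hγ
      | true => exact ⟨c i, .refl 0 _, .base (hX _ _ _ (hcoind i hi))⟩
    choose x hx hxc using hex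
    obtain ⟨s', hs'⟩ := hs.exists_replace fun i => (hx i).concl_eq hZ
    have hss' : DeepRed.{u, v, w} Z 0 s s' := .congr hZ hs hs' fun i => by
      rw [Nat.zero_sub]
      exact hx i
    exact ⟨s', hss', .node hs' ht ((hss'.concl_eq hZ).symm.trans hst) hxc⟩

theorem SplitRule.deepRed (hZ : ∀ s t, Z s t → s.concl = t.concl)
    {X : Ordinal.{w} → DTree D → DTree D → Prop}
    (hX : ∀ δ s' t', X δ s' t' → SplitRule Z X δ s' t') (γ : Ordinal.{w}) (s t : DTree D)
    (h : SplitRule Z X γ s t) : DeepRed.{u, v, w} Z 0 s t := by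
  induction γ using WellFoundedLT.induction generalizing s t with
  | ind γ ih =>
    have href := fun (k : ℕ) (s : DTree D) (h : RelatedBelow (SplitRule Z X γ) k s t) =>
      h.refine hZ fun _ _ h => SplitRule.refine hZ hX ih h
    choose next hnext hrel using href
    let x : ∀ k, {s : DTree D // RelatedBelow (SplitRule Z X γ) k s t} := fun k =>
      Nat.rec ⟨s, .base h⟩ (fun k y => ⟨next k y.1 y.2, hrel k y.1 y.2⟩) k
    exact DeepRed.of_tendsto (s := fun k => (x k).1) hZ (fun k => hnext k (x k).1 (x k).2)
      fun k => (x k).2.agreeTo fun _ _ h => h.concl_eq hZ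

end Composition

theorem mainTheorem1 {S : Type u} {R : Type v} (D : R → DerivationRule S)
    (Z : DTree D → DTree D → Prop) (hZ : ∀ s t, Z s t → s.concl = t.concl) (s t : DTree D) :
    InfRed.{u, v, w} Z s t ↔ ∃ γ : Ordinal.{w}, γ < ω₁ ∧ CoindRed Z γ s t := by
  refine ⟨InfRed.exists_coindRed hZ, ?_⟩
  rintro ⟨γ, -, X, hX, h⟩
  exact (SplitRule.deepRed hZ hX γ s t (hX γ s t h)).infRed
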